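/- **Lemma (Gegenbauer expansion of the binomial).** Let $p\in\mathbb{N}_0=\{0,1,2,\ldots\}$, $\mu\in(-\tfrac12,\infty)\setminus\{0\}$, $z\in\mathbb{C}\setminus(-\infty,1]$ and $x\in\mathbb{C}$. Then $$ (z-x)^p=\frac{2^{\mu+\frac12}}{\sqrt{\pi}}\,e^{i\pi(p-\mu-\frac12)}\,\Gamma(\mu)\,p!\,(z^2-1)^{\frac{p+\mu}{2}+\frac14} \sum_{n=0}^{p}\frac{(-1)^n\,(n+\mu)\,C_n^{\mu}(x)}{(p-n)!\,\Gamma(n+p+2\mu+1)}\;Q_{n+\mu-\frac12}^{\,p+\mu+\frac12}(z). $$ Here $(z^2-1)^{\alpha}:=(z+1)^{\alpha}(z-1)^{\alpha}$, all complex powers are principal values, and $(a)_n=a(a+1)\cdots(a+n-1)$, $(a)_0=1$. The Gauss hypergeometric function is ${}_2F_1(a,b;c;w)=\sum_{k\ge0}\frac{(a)_k(b)_k}{(c)_k}\frac{w^k}{k!}$ for $|w|<1$, continued analytically to $w\in\mathbb{C}\setminus[1,\infty)$; when $a$ or $b$ is a non-positive integer the series terminates and is used for all $w\in\mathbb{C}$.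 The Gegenbauer polynomial is $$C_n^{\mu}(x)=\frac{(2\mu)_n}{n!}\,{}_2F_1\!\left(-n,\,n+2\mu;\,\mu+\tfrac12;\,\tfrac{1-x}{2}\right),$$ and the associated Legendre function of the second kind is, for $z\in\mathbb{C}\setminus(-\infty,1]$, $$Q_\nu^{\lambda}(z)=\frac{\sqrt{\pi}\,e^{i\pi\lambda}\,\Gamma(\nu+\lambda+1)\,(z^2-1)^{\lambda/2}}{2^{\nu+1}\,\Gamma(\nu+\frac32)\,z^{\nu+\lambda+1}}\;{}_2F_1\!\left(\tfrac{\nu+\lambda+1}{2},\,\tfrac{\nu+\lambda+2}{2};\,\nu+\tfrac32;\,\tfrac1{z^2}\right).$$ -/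

import Mathlib

noncomputable section

/-- The complex plane cut along `[1, ∞)`, where the Gauss hypergeometric function lives. -/
def gaussDomain : Set ℂ := (Complex.ofReal '' Set.Ici (1 : ℝ))ᶜ

/-- `F` is an analytic continuation to `ℂ ∖ [1, ∞)` of the Gauss hypergeometric series
`∑ (a)ₙ (b)ₙ / (c)ₙ * wⁿ / n!` (`ordinaryHypergeometric a b c`), which converges for `‖w‖ < 1`. -/
def IsGaussContinuation (a b c : ℂ) (F : ℂ → ℂ) : Prop :=
  DifferentiableOn ℂ F gaussDomain ∧
    ∀ w : ℂ, ‖w‖ < 1 → F w = ordinaryHypergeometric a b c w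

open Classical in
/-- The (principal branch of the) Gauss hypergeometric function `₂F₁(a, b; c; w)` on
`ℂ ∖ [1, ∞)`: the analytic continuation of its power series. The continuation exists whenever
`c` is not a non-positive integer, and it is unique (`gaussHypergeometric_eq`). -/
def gaussHypergeometric (a b c w : ℂ) : ℂ :=
  if h : ∃ F : ℂ → ℂ, IsGaussContinuation a b c F then h.choose w else 0

theorem gaussHypergeometric_eq {a b c : ℂ} {F : ℂ → ℂ} (hF : IsGaussContinuation a b c F)
    {w : ℂ} (hw : w ∈ gaussDomain) : gaussHypergeometric a b c w = F w := by
  have h : ∃ F : ℂ → ℂ, IsGaussContinuation a b c F := ⟨F, hF⟩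
  have hopen : IsOpen gaussDomain :=
    (Complex.isometry_ofReal.isClosedEmbedding.isClosedMap _ isClosed_Ici).isOpen_compl
  have h0 : (0 : ℂ) ∈ gaussDomain := by
    rintro ⟨t, ht, h⟩
    have : t = 0 := by exact_mod_cast h
    subst this
    exact absurd ht (by simp)
  have hstar : StarConvex ℝ 0 gaussDomain := by
    rw [starConvex_zero_iff]
    intro v hv r hr0 hr1
    refine fun hmem => ?_
    obtain ⟨t, ht, hrt⟩ := hmem
    have ht1 : (1 : ℝ) ≤ t := ht
    have hr : 0 < r := by
      rcases hr0.lt_or_eq with h | h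
      · exact h
      · subst h
        have : t = 0 := by simpa using hrt
        linarith
    refine hv ⟨t / r, ?_, ?_⟩
    · change 1 ≤ t / r
      rw [le_div_iff₀ hr]
      linarith
    · have : (r : ℂ) ≠ 0 := by exact_mod_cast hr.ne'
      rw [Complex.real_smul] at hrt
      push_cast
      rw [hrt]
      field_simp
  have hpre : IsPreconnected gaussDomain :=
    (hstar.isPathConnected h0).isConnected.isPreconnected
  have key := (h.choose_spec.1.analyticOnNhd hopen).eqOn_of_preconnected_of_eventuallyEq
    (hF.1.analyticOnNhd hopen) hpre h0 (by
      filter_upwards [Metric.ball_mem_nhds (0 : ℂ) one_pos] with v hv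
      have hv' : ‖v‖ < 1 := by simpa using hv
      rw [h.choose_spec.2 v hv', hF.2 v hv'])
  rw [gaussHypergeometric, dif_pos h]
  exact key hw

/-- `(z² - 1)^α`, read as `(z + 1)^α (z - 1)^α` with principal powers, for `z ∈ ℂ ∖ (-∞, 1]`. -/
def sqSubOnePow (z α : ℂ) : ℂ := (z + 1) ^ α * (z - 1) ^ α

/-- The associated Legendre function of the second kind `Q_ν^μ(z)` for `z ∈ ℂ ∖ (-∞, 1]`
(for such `z` one has `1 / z² ∈ ℂ ∖ [1, ∞)`). -/
def legendreQ (ν μ z : ℂ) : ℂ :=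
  (Real.sqrt Real.pi : ℂ) * Complex.exp (Complex.I * Real.pi * μ) * Complex.Gamma (ν + μ + 1)
      * sqSubOnePow z (μ / 2)
    / ((2 : ℂ) ^ (ν + 1) * Complex.Gamma (ν + 3 / 2) * z ^ (ν + μ + 1))
    * gaussHypergeometric ((ν + μ + 1) / 2) ((ν + μ + 2) / 2) (ν + 3 / 2) (1 / z ^ 2)

/-- The Gegenbauer polynomial `C_n^ν(x) = (2ν)ₙ / n! * ₂F₁(-n, n + 2ν; ν + 1/2; (1 - x) / 2)`,
for `ν ∈ (-1/2, ∞) ∖ {0}`; the hypergeometric series terminates, so `x ∈ ℂ` is arbitrary. -/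
def gegenbauerC (n : ℕ) (ν : ℝ) (x : ℂ) : ℂ :=
  (ascPochhammer ℂ n).eval (2 * ν : ℂ) / (n.factorial : ℂ)
    * ordinaryHypergeometric (-n : ℂ) (n + 2 * ν : ℂ) (ν + 1 / 2 : ℂ) ((1 - x) / 2)

end

/-!
The identity is a polynomial one in disguise: in the parameters occurring here, Euler's
transformation `₂F₁(a, b; c; w) = (1 - w) ^ (c - a - b) ₂F₁(c - a, c - b; c; w)` turns the
hypergeometric function of each Legendre function into a terminating series, because `c - a` and
`c - b` are `(1 - m) / 2` and `-m / 2` with `m = p - n ≥ 0`. All non-integral powers then combine to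
`z ^ (p - n)`, and what remains is the expansion of `(z - x) ^ p` in Gegenbauer polynomials in `x`
with polynomial coefficients in `z`.

* Euler's transformation holds on the unit disc by the Cauchy product with the binomial series and
  the summation formula `sum_ascPochhammer_saalschutz`. Its right-hand side is holomorphic on
  `ℂ ∖ [1, ∞)`, so it is the continuation: `gaussHypergeometric_eq_one_sub_cpow_mul_sum`.
* The powers are principal values, so `(z + 1) ^ α (z - 1) ^ α (1 - 1 / z ^ 2) ^ (-α) = z ^ (2 α)`
  requires that no jump of the logarithm occurs for `z ∉ (-∞, 1]`; this is
  `log_add_one_add_log_sub_one`. The outcome is `sqSubOnePow_mul_legendreQ`.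
* Comparing powers of `z`, it remains to expand `x ^ j` in Gegenbauer polynomials
  (`pow_eq_sum_gegenbauerC`). This goes by induction on `j`, multiplication by `x` being described
  by the three-term recurrence `gegenbauerC_recurrence`, which is read off from the coefficients of
  the polynomials in powers of `(1 - x) / 2`.
-/

/-! ### Rising factorials -/

theorem ascPochhammer_eval_add (s : ℂ) (n m : ℕ) :
    (ascPochhammer ℂ (n + m)).eval s
      = (ascPochhammer ℂ n).eval s * (ascPochhammer ℂ m).eval (s + n) := by
  rw [← ascPochhammer_mul]
  simp

theorem ascPochhammer_eval_succ_left (s : ℂ) (n : ℕ) :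
    (ascPochhammer ℂ (n + 1)).eval s = s * (ascPochhammer ℂ n).eval (s + 1) := by
  rw [add_comm n 1, ascPochhammer_eval_add]
  simp

theorem ascPochhammer_eval_ne_zero {s : ℂ} (hs : ∀ k : ℕ, s + k ≠ 0) (n : ℕ) :
    (ascPochhammer ℂ n).eval s ≠ 0 := by
  induction n with
  | zero => simp
  | succ n ih => rw [ascPochhammer_succ_eval]; exact mul_ne_zero ih (hs n)

theorem ascPochhammer_eval_neg_natCast_eq_zero {n k : ℕ} (h : n < k) :
    (ascPochhammer ℂ k).eval (-n : ℂ) = 0 :=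
  (ascPochhammer_eval_eq_zero_iff k _).2 ⟨n, h, by simp⟩

/-! ### Euler's transformation for a terminating hypergeometric series -/

/-- The coefficient identity (Pfaff–Saalschütz) behind Euler's transformation
`₂F₁(c - A, c - B; c; w) = (1 - w)^(A + B - c) ₂F₁(A, B; c; w)`. The left-hand side satisfies the
two-term recurrence in `m` that characterises the right-hand side, by creative telescoping. -/
theorem sum_ascPochhammer_saalschutz (A B c : ℂ) (hc : ∀ k : ℕ, c + k ≠ 0) (m : ℕ) :
    ∑ k ∈ Finset.range (m + 1),
        (ascPochhammer ℂ k).eval A * (ascPochhammer ℂ k).eval B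
          / ((ascPochhammer ℂ k).eval c * (k.factorial : ℂ))
          * ((ascPochhammer ℂ (m - k)).eval (c - A - B) / ((m - k).factorial : ℂ)) =
      (ascPochhammer ℂ m).eval (c - A) * (ascPochhammer ℂ m).eval (c - B)
        / ((ascPochhammer ℂ m).eval c * (m.factorial : ℂ)) := by
  have hp := ascPochhammer_eval_ne_zero hc
  have hf : ∀ k : ℕ, (k.factorial : ℂ) ≠ 0 := fun k => by exact_mod_cast k.factorial_ne_zero
  induction m with
  | zero => simp
  | succ m ih =>
    set t : ℕ → ℕ → ℂ := fun m k =>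
      (ascPochhammer ℂ k).eval A * (ascPochhammer ℂ k).eval B
          / ((ascPochhammer ℂ k).eval c * (k.factorial : ℂ))
          * ((ascPochhammer ℂ (m - k)).eval (c - A - B) / ((m - k).factorial : ℂ)) with ht
    -- The telescoping certificate.
    set g : ℕ → ℂ := fun k =>
      -(k * (c + k - 1) * ((ascPochhammer ℂ k).eval A * (ascPochhammer ℂ k).eval B
          / ((ascPochhammer ℂ k).eval c * (k.factorial : ℂ))
          * ((ascPochhammer ℂ (m + 1 - k)).eval (c - A - B) / ((m + 1 - k).factorial : ℂ)))) with hg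
    have hstep : ∀ k ∈ Finset.range (m + 1),
        (m + 1) * (m + c) * t (m + 1) k - (m + (c - A)) * (m + (c - B)) * t m k
          = g (k + 1) - g k := by
      intro k hk
      obtain ⟨j, rfl⟩ := Nat.exists_eq_add_of_le (Nat.lt_succ_iff.mp (Finset.mem_range.mp hk))
      have e1 : k + j - k = j := by omega
      have e2 : k + j + 1 - k = j + 1 := by omega
      have e3 : k + j + 1 - (k + 1) = j := by omega
      have := hp k
      have := hf k
      have := hf j
      have := hc k
      have hk1 : (k : ℂ) + 1 ≠ 0 := Nat.cast_add_one_ne_zero k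
      have hj1 : (j : ℂ) + 1 ≠ 0 := Nat.cast_add_one_ne_zero j
      simp only [ht, hg, e1, e2, e3, ascPochhammer_succ_eval, Nat.factorial_succ]
      push_cast
      have hck : c + ((k : ℂ) + 1) - 1 = c + k := by ring
      rw [hck]
      field_simp
      ring
    have hsum := Finset.sum_congr rfl hstep
    rw [Finset.sum_range_sub, Finset.sum_sub_distrib, ← Finset.mul_sum, ← Finset.mul_sum] at hsum
    change ∑ k ∈ Finset.range (m + 1), t m k = _ at ih
    change ∑ k ∈ Finset.range (m + 1 + 1), t (m + 1) k = _
    rw [ih] at hsum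
    rw [Finset.sum_range_succ]
    have hm1 : (m : ℂ) + 1 ≠ 0 := Nat.cast_add_one_ne_zero m
    have hmc : (m : ℂ) + c ≠ 0 := by rw [add_comm]; exact hc m
    have hlast : (m + 1) * (m + c) * t (m + 1) (m + 1) = -g (m + 1) := by
      simp only [ht, hg]
      push_cast
      ring
    have hg0 : g 0 = 0 := by simp [hg]
    have key : (m + 1) * (m + c) * (∑ k ∈ Finset.range (m + 1), t (m + 1) k + t (m + 1) (m + 1))
        = (m + (c - A)) * (m + (c - B)) *
          ((ascPochhammer ℂ m).eval (c - A) * (ascPochhammer ℂ m).eval (c - B)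
            / ((ascPochhammer ℂ m).eval c * (m.factorial : ℂ))) := by
      linear_combination hsum + hlast - hg0
    apply mul_left_cancel₀ (mul_ne_zero hm1 hmc)
    rw [key]
    simp only [ascPochhammer_succ_eval, Nat.factorial_succ]
    push_cast
    have := hp m
    have := hf m
    have := hc m
    field_simp
    ring

theorem hasSum_one_sub_cpow_neg (s : ℂ) {w : ℂ} (hw : ‖w‖ < 1) :
    HasSum (fun n : ℕ => (ascPochhammer ℂ n).eval s / (n.factorial : ℂ) * w ^ n)
      ((1 - w) ^ (-s)) := by
  have h := (Complex.one_div_one_sub_cpow_hasFPowerSeriesOnBall_zero s).hasSum (y := w) (by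
    simpa [Metric.mem_eball, edist_zero_right, enorm_eq_nnnorm, ← NNReal.coe_lt_coe] using hw)
  have hcoef : ∀ n : ℕ, Ring.choose (s + n - 1) n
      = (ascPochhammer ℂ n).eval s / (n.factorial : ℂ) := by
    intro n
    have hf : (n.factorial : ℂ) ≠ 0 := by exact_mod_cast n.factorial_ne_zero
    rw [eq_div_iff hf]
    have h1 := Ring.factorial_nsmul_multichoose_eq_ascPochhammer s n
    rw [nsmul_eq_mul, Polynomial.ascPochhammer_smeval_eq_eval] at h1
    rw [← h1, mul_comm, Ring.choose]
    congr 2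
    ring
  simp only [zero_add, FormalMultilinearSeries.ofScalars_apply_eq, hcoef, smul_eq_mul] at h
  simpa [Complex.cpow_neg] using h

/-- **Euler's transformation** on the unit disc, when the transformed series terminates. -/
theorem ordinaryHypergeometric_eq_one_sub_cpow_mul_sum (A B c : ℂ) (hc : ∀ k : ℕ, c + k ≠ 0)
    (N : ℕ) (hN : ∀ k, N < k → (ascPochhammer ℂ k).eval A * (ascPochhammer ℂ k).eval B = 0)
    {w : ℂ} (hw : ‖w‖ < 1) :
    ordinaryHypergeometric (c - A) (c - B) c w =
      (1 - w) ^ (A + B - c) * ∑ k ∈ Finset.range (N + 1),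
        (ascPochhammer ℂ k).eval A * (ascPochhammer ℂ k).eval B
          / ((ascPochhammer ℂ k).eval c * (k.factorial : ℂ)) * w ^ k := by
  set u : ℕ → ℂ := fun k => (ascPochhammer ℂ k).eval A * (ascPochhammer ℂ k).eval B
          / ((ascPochhammer ℂ k).eval c * (k.factorial : ℂ)) * w ^ k with hu
  have hu0 : ∀ k ∉ Finset.range (N + 1), u k = 0 := by
    intro k hk
    have : N < k := by simpa using hk
    simp [hu, hN k this]
  have hus : Summable fun k => ‖u k‖ := (summable_of_ne_finset_zero hu0).norm
  have hv := hasSum_one_sub_cpow_neg (c - A - B) hw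
  have hprod := tsum_mul_tsum_eq_tsum_sum_range_of_summable_norm hus hv.summable.norm
  rw [tsum_eq_sum hu0, hv.tsum_eq] at hprod
  rw [ordinaryHypergeometric_eq_tsum, show A + B - c = -(c - A - B) by ring, mul_comm, hprod]
  refine tsum_congr fun m => ?_
  have hs := sum_ascPochhammer_saalschutz A B c hc m
  rw [smul_eq_mul]
  calc _ = (ascPochhammer ℂ m).eval (c - A) * (ascPochhammer ℂ m).eval (c - B)
        / ((ascPochhammer ℂ m).eval c * (m.factorial : ℂ)) * w ^ m := by
        rw [div_eq_mul_inv, mul_inv]; ring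
    _ = _ := by
        rw [← hs, Finset.sum_mul]
        refine Finset.sum_congr rfl fun k hk => ?_
        have hkm : w ^ m = w ^ k * w ^ (m - k) := by
          rw [← pow_add, Nat.add_sub_cancel' (Nat.lt_succ_iff.mp (Finset.mem_range.mp hk))]
        rw [hkm]
        simp only [hu]
        ring

theorem one_sub_mem_slitPlane_of_mem_gaussDomain {w : ℂ} (hw : w ∈ gaussDomain) :
    1 - w ∈ Complex.slitPlane := by
  rw [Complex.mem_slitPlane_iff]
  by_contra! h
  refine hw ⟨w.re, ?_, ?_⟩
  · have := h.1
    simp at this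
    simpa using this
  · have := h.2
    simp at this
    exact Complex.ext (by simp) (by simp [this])

/-- **Euler's transformation** on `ℂ ∖ [1, ∞)`, when the transformed series terminates. -/
theorem gaussHypergeometric_eq_one_sub_cpow_mul_sum (A B c : ℂ) (hc : ∀ k : ℕ, c + k ≠ 0)
    (N : ℕ) (hN : ∀ k, N < k → (ascPochhammer ℂ k).eval A * (ascPochhammer ℂ k).eval B = 0)
    {w : ℂ} (hw : w ∈ gaussDomain) :
    gaussHypergeometric (c - A) (c - B) c w =
      (1 - w) ^ (A + B - c) * ∑ k ∈ Finset.range (N + 1),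
        (ascPochhammer ℂ k).eval A * (ascPochhammer ℂ k).eval B
          / ((ascPochhammer ℂ k).eval c * (k.factorial : ℂ)) * w ^ k := by
  refine gaussHypergeometric_eq (F := fun w => (1 - w) ^ (A + B - c) *
    ∑ k ∈ Finset.range (N + 1), (ascPochhammer ℂ k).eval A * (ascPochhammer ℂ k).eval B
          / ((ascPochhammer ℂ k).eval c * (k.factorial : ℂ)) * w ^ k) ⟨?_, ?_⟩ hw
  · refine DifferentiableOn.mul ?_ ?_
    · exact DifferentiableOn.cpow (by fun_prop) (by fun_prop)
        fun v hv => one_sub_mem_slitPlane_of_mem_gaussDomain hv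
    · fun_prop
  · exact fun v hv => (ordinaryHypergeometric_eq_one_sub_cpow_mul_sum A B c hc N hN hv).symm ▸ rfl

/-! ### The branch of `(z² - 1)^α` -/

theorem log_mul_of_im_pos_of_im_neg {a b : ℂ} (ha : 0 < a.im) (hb : b.im < 0) :
    Complex.log (a * b) = Complex.log a + Complex.log b := by
  have ha0 : a ≠ 0 := by rintro rfl; simp at ha
  have hb0 : b ≠ 0 := by rintro rfl; simp at hb
  refine Complex.log_mul ha0 hb0 ⟨?_, ?_⟩
  · linarith [Complex.arg_nonneg_iff.mpr ha.le, Complex.neg_pi_lt_arg b]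
  · linarith [Complex.arg_neg_iff.mpr hb, Complex.arg_le_pi a]

theorem log_mul_of_im_mul_im_neg {a b : ℂ} (h : a.im * b.im < 0) :
    Complex.log (a * b) = Complex.log a + Complex.log b := by
  rcases mul_neg_iff.mp h with ⟨ha, hb⟩ | ⟨ha, hb⟩
  · exact log_mul_of_im_pos_of_im_neg ha hb
  · rw [mul_comm, log_mul_of_im_pos_of_im_neg hb ha, add_comm]

theorem im_mul_im_inv_neg {z : ℂ} (hz : z.im ≠ 0) : z.im * (z⁻¹).im < 0 := by
  have h0 : z ≠ 0 := by rintro rfl; simp at hz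
  rw [Complex.inv_im, mul_div_assoc', mul_neg, neg_div, neg_lt_zero]
  exact div_pos (mul_self_pos.mpr hz) (Complex.normSq_pos.mpr h0)

/-- The principal logarithms of `z + 1` and `z - 1` add up without a jump of `2πi`. Off the real
axis, each product rule used multiplies two numbers on opposite sides of it:
`z + 1 = z (1 + 1/z)`, `z = (z - 1) (1 + 1/(z - 1))` and `1 - 1/z² = (1 + 1/z) (1 - 1/z)`. -/
theorem log_add_one_add_log_sub_one {z : ℂ} (hz : z ∉ Complex.ofReal '' Set.Iic (1 : ℝ)) :
    Complex.log (z + 1) + Complex.log (z - 1)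
      = 2 * Complex.log z + Complex.log (1 - 1 / z ^ 2) := by
  by_cases him : z.im = 0
  · obtain ⟨r, rfl⟩ : ∃ r : ℝ, (r : ℂ) = z := ⟨z.re, Complex.ext (by simp) (by simp [him])⟩
    have hr : 1 < r := by
      by_contra h
      exact hz ⟨r, not_lt.mp h, rfl⟩
    have h1 : 0 < 1 - 1 / r ^ 2 := by
      rw [sub_pos, div_lt_one (by positivity)]
      nlinarith
    have e1 : (r : ℂ) + 1 = ((r + 1 : ℝ) : ℂ) := by push_cast; ring
    have e2 : (r : ℂ) - 1 = ((r - 1 : ℝ) : ℂ) := by push_cast; ring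
    have e3 : 1 - 1 / (r : ℂ) ^ 2 = ((1 - 1 / r ^ 2 : ℝ) : ℂ) := by push_cast; ring
    rw [e1, e2, e3, ← Complex.ofReal_log (by linarith), ← Complex.ofReal_log (by linarith),
      ← Complex.ofReal_log (by linarith), ← Complex.ofReal_log h1.le]
    norm_cast
    rw [← Real.log_mul (by linarith) (by linarith), two_mul,
      ← Real.log_mul (by linarith) (by linarith), ← Real.log_mul (by positivity) h1.ne']
    congr 1
    field_simp
    ring
  · have h0 : z ≠ 0 := by rintro rfl; simp at him
    have h1 : z - 1 ≠ 0 := by intro h; apply him; rw [sub_eq_zero.mp h]; simp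
    have him1 : (z - 1).im ≠ 0 := by simpa using him
    have hI := im_mul_im_inv_neg him
    have hI1 := im_mul_im_inv_neg him1
    have a1 : Complex.log (z + 1) = Complex.log z + Complex.log (1 + z⁻¹) := by
      rw [← log_mul_of_im_mul_im_neg (by simpa using hI)]
      congr 1
      field_simp
    have a2 : Complex.log z = Complex.log (z - 1) + Complex.log (1 + (z - 1)⁻¹) := by
      rw [← log_mul_of_im_mul_im_neg (by simpa using hI1)]
      congr 1
      field_simp
      ring
    have a3 : Complex.log (1 - z⁻¹) = -Complex.log (1 + (z - 1)⁻¹) := by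
      rw [← Complex.log_inv]
      · congr 1
        have : 1 + (z - 1)⁻¹ = z / (z - 1) := by field_simp; ring
        rw [this]
        field_simp
      · intro h
        have hi := (Complex.arg_eq_pi_iff.mp h).2
        have : ((z - 1)⁻¹).im = 0 := by simpa using hi
        rw [this] at hI1
        simp at hI1
    have a4 : Complex.log (1 - 1 / z ^ 2) = Complex.log (1 + z⁻¹) + Complex.log (1 - z⁻¹) := by
      rw [← log_mul_of_im_mul_im_neg]
      · congr 1
        field_simp
        ring
      · have hne : (z⁻¹).im ≠ 0 := by intro h; rw [h] at hI; simp at hI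
        have := mul_self_pos.mpr hne
        simp only [Complex.add_im, Complex.sub_im, Complex.one_im]
        linarith
    linear_combination a1 - a2 - a4 - a3

theorem ne_zero_of_notMem_image_Iic {z : ℂ} (hz : z ∉ Complex.ofReal '' Set.Iic (1 : ℝ)) :
    z ≠ 0 := by
  rintro rfl
  exact hz ⟨0, by simp, by simp⟩

theorem one_div_sq_mem_gaussDomain {z : ℂ} (hz : z ∉ Complex.ofReal '' Set.Iic (1 : ℝ)) :
    1 / z ^ 2 ∈ gaussDomain := by
  rintro ⟨t, ht, h⟩
  have ht : 1 ≤ t := ht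
  have h0 := ne_zero_of_notMem_image_Iic hz
  have ht0 : (t : ℂ) ≠ 0 := by exact_mod_cast (by linarith : t ≠ 0)
  have hz2 : z ^ 2 = ((t⁻¹ : ℝ) : ℂ) := by
    push_cast
    rw [h]
    simp
  have hs : ((√(t⁻¹) : ℝ) : ℂ) ^ 2 = ((t⁻¹ : ℝ) : ℂ) := by
    rw [← Complex.ofReal_pow, Real.sq_sqrt (by positivity)]
  have hle : √(t⁻¹) ≤ 1 := Real.sqrt_le_one.mpr (inv_le_one_of_one_le₀ ht)
  rcases sq_eq_sq_iff_eq_or_eq_neg.mp (hz2.trans hs.symm) with e | e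
  · exact hz ⟨√(t⁻¹), hle, e.symm⟩
  · refine hz ⟨-√(t⁻¹), ?_, by rw [e]; simp⟩
    have := Real.sqrt_nonneg (t⁻¹)
    change -√(t⁻¹) ≤ 1
    linarith

theorem add_one_ne_zero_of_notMem_image_Iic {z : ℂ}
    (hz : z ∉ Complex.ofReal '' Set.Iic (1 : ℝ)) : z + 1 ≠ 0 :=
  fun h => hz ⟨-1, by simp, by simp [eq_neg_of_add_eq_zero_left h]⟩

theorem sub_one_ne_zero_of_notMem_image_Iic {z : ℂ}
    (hz : z ∉ Complex.ofReal '' Set.Iic (1 : ℝ)) : z - 1 ≠ 0 :=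
  fun h => hz ⟨1, by simp, by simp [sub_eq_zero.mp h]⟩

theorem sqSubOnePow_add {z : ℂ} (hz : z ∉ Complex.ofReal '' Set.Iic (1 : ℝ)) (α β : ℂ) :
    sqSubOnePow z (α + β) = sqSubOnePow z α * sqSubOnePow z β := by
  rw [sqSubOnePow, sqSubOnePow, sqSubOnePow,
    Complex.cpow_add _ _ (add_one_ne_zero_of_notMem_image_Iic hz),
    Complex.cpow_add _ _ (sub_one_ne_zero_of_notMem_image_Iic hz)]
  ring

theorem sqSubOnePow_mul_one_sub_cpow_neg {z : ℂ} (hz : z ∉ Complex.ofReal '' Set.Iic (1 : ℝ))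
    (α : ℂ) : sqSubOnePow z α * (1 - 1 / z ^ 2) ^ (-α) = z ^ (2 * α) := by
  have h1 : 1 - 1 / z ^ 2 ≠ 0 := by
    have := one_sub_mem_slitPlane_of_mem_gaussDomain (one_div_sq_mem_gaussDomain hz)
    exact Complex.slitPlane_ne_zero this
  rw [sqSubOnePow, Complex.cpow_def_of_ne_zero (add_one_ne_zero_of_notMem_image_Iic hz),
    Complex.cpow_def_of_ne_zero (sub_one_ne_zero_of_notMem_image_Iic hz),
    Complex.cpow_def_of_ne_zero h1, Complex.cpow_def_of_ne_zero (ne_zero_of_notMem_image_Iic hz),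
    ← Complex.exp_add, ← Complex.exp_add]
  congr 1
  linear_combination α * log_add_one_add_log_sub_one hz

/-! ### Powers as sums of Gegenbauer polynomials -/

/-- The coefficient of `((1 - x) / 2) ^ k` in the Gegenbauer polynomial `C_n^μ(x)`;
it vanishes for `n < k`. -/
noncomputable def gegenbauerCoeff (μ : ℝ) (n k : ℕ) : ℂ :=
  (ascPochhammer ℂ k).eval (-n : ℂ) * (ascPochhammer ℂ (n + k)).eval (2 * μ : ℂ)
    / ((n.factorial : ℂ) * (k.factorial : ℂ) * (ascPochhammer ℂ k).eval (μ + 1 / 2 : ℂ))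

theorem gegenbauerC_eq_sum (μ : ℝ) (x : ℂ) {n M : ℕ} (h : n < M) :
    gegenbauerC n μ x = ∑ k ∈ Finset.range M, gegenbauerCoeff μ n k * ((1 - x) / 2) ^ k := by
  rw [gegenbauerC, ordinaryHypergeometric_eq_tsum]
  beta_reduce
  rw [tsum_eq_sum (s := Finset.range M), Finset.mul_sum]
  · refine Finset.sum_congr rfl fun k _ => ?_
    rw [gegenbauerCoeff, ascPochhammer_eval_add, smul_eq_mul, add_comm (2 * (μ : ℂ))]
    simp only [div_eq_mul_inv, mul_inv]
    ring
  · intro k hk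
    have : n < k := lt_of_lt_of_le h (by simpa using hk)
    simp [ascPochhammer_eval_neg_natCast_eq_zero this]

theorem add_half_add_natCast_ne_zero {μ : ℝ} (hμ : -(1 / 2) < μ) (k : ℕ) :
    (μ + 1 / 2 : ℂ) + k ≠ 0 := by
  have h : (0 : ℝ) < μ + 1 / 2 + k := by
    have : (0 : ℝ) ≤ k := k.cast_nonneg
    linarith
  have := h.ne'
  exact_mod_cast (by simpa using (Complex.ofReal_ne_zero.mpr this))

theorem add_natCast_ne_zero {μ : ℝ} (hμ : -(1 / 2) < μ) (hμ0 : μ ≠ 0) (k : ℕ) :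
    (μ : ℂ) + k ≠ 0 := by
  have h : μ + (k : ℝ) ≠ 0 := by
    rcases k with _ | k
    · simpa using hμ0
    · have : (0 : ℝ) ≤ k := k.cast_nonneg
      push_cast
      linarith
  exact_mod_cast Complex.ofReal_ne_zero.mpr h

theorem gegenbauerC_zero (μ : ℝ) (x : ℂ) : gegenbauerC 0 μ x = 1 := by
  rw [gegenbauerC_eq_sum μ x (n := 0) (M := 1) (by norm_num)]
  simp [gegenbauerCoeff]

theorem gegenbauerC_one {μ : ℝ} (hμ : -(1 / 2) < μ) (x : ℂ) :
    gegenbauerC 1 μ x = 2 * μ * x := by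
  rw [gegenbauerC_eq_sum μ x (n := 1) (M := 2) (by norm_num)]
  have h := add_half_add_natCast_ne_zero hμ 0
  simp only [Finset.sum_range_succ, Finset.sum_range_zero, gegenbauerCoeff,
    ascPochhammer_succ_eval, ascPochhammer_zero, Nat.factorial]
  generalize hH : (μ : ℂ) + 1 / 2 + ((0 : ℕ) : ℂ) = H at *
  have hm : (μ : ℂ) = H - 1 / 2 := by rw [← hH]; simp
  push_cast
  simp only [Polynomial.eval_one]
  field_simp
  rw [hm]
  ring

/-- The three-term recurrence of the Gegenbauer polynomials. -/
theorem gegenbauerC_recurrence {μ : ℝ} (hμ : -(1 / 2) < μ) (n : ℕ) (x : ℂ) :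
    2 * (n + 1 + μ) * x * gegenbauerC (n + 1) μ x
      = (n + 2) * gegenbauerC (n + 2) μ x + (n + 2 * μ) * gegenbauerC n μ x := by
  obtain ⟨t, rfl⟩ : ∃ t : ℂ, x = 1 - 2 * t := ⟨(1 - x) / 2, by ring⟩
  have et : (1 - (1 - 2 * t)) / 2 = t := by ring
  have hq := ascPochhammer_eval_ne_zero (add_half_add_natCast_ne_zero hμ)
  have hf : ∀ k : ℕ, (k.factorial : ℂ) ≠ 0 := fun k => by exact_mod_cast k.factorial_ne_zero
  have hn1 : (n : ℂ) + 1 ≠ 0 := Nat.cast_add_one_ne_zero n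
  have hn2 : (n : ℂ) + 1 + 1 ≠ 0 := by exact_mod_cast Nat.cast_add_one_ne_zero (R := ℂ) (n + 1)
  have h0 : 2 * (n + 1 + μ) * gegenbauerCoeff μ (n + 1) 0
      = (n + 2) * gegenbauerCoeff μ (n + 2) 0 + (n + 2 * μ) * gegenbauerCoeff μ n 0 := by
    simp only [gegenbauerCoeff, add_zero, ascPochhammer_zero, Polynomial.eval_one,
      ascPochhammer_succ_eval, Nat.factorial_succ]
    have := hf n
    push_cast
    field_simp
    ring
  have hk : ∀ k : ℕ, 2 * (n + 1 + μ) * (gegenbauerCoeff μ (n + 1) (k + 1)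
        - 2 * gegenbauerCoeff μ (n + 1) k)
      = (n + 2) * gegenbauerCoeff μ (n + 2) (k + 1)
        + (n + 2 * μ) * gegenbauerCoeff μ n (k + 1) := by
    intro k
    -- All four coefficients are multiples of the one of index `(n + 1, k)`.
    have e1 : (ascPochhammer ℂ (k + 1)).eval (-((n + 2 : ℕ) : ℂ))
        = -(n + 2) * (ascPochhammer ℂ k).eval (-((n + 1 : ℕ) : ℂ)) := by
      rw [ascPochhammer_eval_succ_left]
      push_cast
      congr 2
      ring
    have e2 : (ascPochhammer ℂ (k + 1)).eval (-(n : ℂ))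
        = -((ascPochhammer ℂ k).eval (-((n + 1 : ℕ) : ℂ)) * (k - n - 1) * (k - n)) / (n + 1) := by
      have := ascPochhammer_eval_succ_left (-((n + 1 : ℕ) : ℂ)) (k + 1)
      rw [show -((n + 1 : ℕ) : ℂ) + 1 = -(n : ℂ) by push_cast; ring] at this
      rw [ascPochhammer_succ_eval (k + 1), ascPochhammer_succ_eval k (-((n + 1 : ℕ) : ℂ))] at this
      rw [eq_div_iff hn1]
      push_cast at this ⊢
      linear_combination this
    have e3 : n + 2 + (k + 1) = n + k + 1 + 1 + 1 := by ring
    have e4 : n + 1 + (k + 1) = n + k + 1 + 1 := by ring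
    have e5 : n + 1 + k = n + k + 1 := by ring
    have e6 : n + (k + 1) = n + k + 1 := by ring
    simp only [gegenbauerCoeff]
    rw [e1, e2, e3, e4, e5, e6, ascPochhammer_succ_eval k (-((n + 1 : ℕ) : ℂ)),
      ascPochhammer_succ_eval k ((μ : ℂ) + 1 / 2), ascPochhammer_succ_eval (n + k + 1 + 1),
      ascPochhammer_succ_eval (n + k + 1)]
    simp only [Nat.factorial_succ]
    have := hf n
    have := hf k
    have := hq k
    have hk1 : (k : ℂ) + 1 ≠ 0 := Nat.cast_add_one_ne_zero k
    have hh := add_half_add_natCast_ne_zero hμ k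
    generalize (ascPochhammer ℂ k).eval (-((n + 1 : ℕ) : ℂ)) = P
    generalize (ascPochhammer ℂ (n + k + 1)).eval (2 * (μ : ℂ)) = R
    generalize (ascPochhammer ℂ k).eval ((μ : ℂ) + 1 / 2) = Q at *
    generalize hH : (μ : ℂ) + 1 / 2 + k = H at *
    have hm : (μ : ℂ) = H - 1 / 2 - k := by rw [← hH]; ring
    push_cast
    field_simp
    rw [hm]
    ring
  rw [gegenbauerC_eq_sum μ _ (n := n + 2) (M := n + 2 + 1) (by omega),
    gegenbauerC_eq_sum μ _ (n := n) (M := n + 2 + 1) (by omega), et]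
  calc 2 * (n + 1 + μ) * (1 - 2 * t) * gegenbauerC (n + 1) μ (1 - 2 * t)
      = 2 * (n + 1 + μ) * gegenbauerC (n + 1) μ (1 - 2 * t)
        - 2 * (n + 1 + μ) * (2 * t) * gegenbauerC (n + 1) μ (1 - 2 * t) := by ring
    _ = 2 * (n + 1 + μ) * (∑ k ∈ Finset.range (n + 2 + 1), gegenbauerCoeff μ (n + 1) k * t ^ k)
        - 2 * (n + 1 + μ) * (2 * t)
          * ∑ k ∈ Finset.range (n + 2), gegenbauerCoeff μ (n + 1) k * t ^ k := by
        conv_lhs =>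
          rw [gegenbauerC_eq_sum μ _ (n := n + 1) (M := n + 2) (by omega)]
        conv_rhs => rw [← et, ← gegenbauerC_eq_sum μ _ (n := n + 1) (M := n + 2 + 1) (by omega)]
        rw [← gegenbauerC_eq_sum μ _ (n := n + 1) (M := n + 2) (by omega), et]
    _ = _ := by
        rw [Finset.sum_range_succ' _ (n + 2), Finset.sum_range_succ' _ (n + 2),
          Finset.sum_range_succ' _ (n + 2)]
        have hs : 2 * (n + 1 + μ)
              * ((∑ k ∈ Finset.range (n + 2), gegenbauerCoeff μ (n + 1) (k + 1) * t ^ (k + 1))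
                - 2 * t * ∑ k ∈ Finset.range (n + 2), gegenbauerCoeff μ (n + 1) k * t ^ k)
            = (n + 2)
                * (∑ k ∈ Finset.range (n + 2), gegenbauerCoeff μ (n + 2) (k + 1) * t ^ (k + 1))
              + (n + 2 * μ)
                * ∑ k ∈ Finset.range (n + 2), gegenbauerCoeff μ n (k + 1) * t ^ (k + 1) := by
          simp only [Finset.mul_sum, ← Finset.sum_sub_distrib, ← Finset.sum_add_distrib]
          refine Finset.sum_congr rfl fun k _ => ?_
          linear_combination t ^ (k + 1) * hk k
        simp only [pow_zero, mul_one]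
        linear_combination hs + h0

/-- The coefficient of `(n + μ) C_n^μ(x)` with `n = j - 2 * k` in the expansion of `x ^ j` in
Gegenbauer polynomials. It is set to `0` unless `n + 2 * k = j`, so that `n` and `k` can be summed
over independently and no truncated subtraction occurs. -/
noncomputable def powGegenbauerCoeff (μ : ℝ) (j n k : ℕ) : ℂ :=
  if n + 2 * k = j then
    (j.factorial : ℂ) / (2 ^ j * (ascPochhammer ℂ (n + k + 1)).eval (μ : ℂ) * (k.factorial : ℂ))
  else 0

theorem powGegenbauerCoeff_of_ne {μ : ℝ} {j n k : ℕ} (h : n + 2 * k ≠ j) :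
    powGegenbauerCoeff μ j n k = 0 := if_neg h

/-- The recurrence of the expansion coefficients that corresponds to multiplication by `x`. The two
terms on the right are absent for `n = 0` and for `k = 0`, respectively; in the first the factor `n`
annihilates the junk index `0 - 1`. -/
theorem powGegenbauerCoeff_succ {μ : ℝ} (hμ : -(1 / 2) < μ) (hμ0 : μ ≠ 0) (j n k : ℕ) :
    2 * (powGegenbauerCoeff μ (j + 1) n k * (n + μ))
      = n * powGegenbauerCoeff μ j (n - 1) k
        + if k = 0 then 0 else (n + 2 * μ) * powGegenbauerCoeff μ j (n + 1) (k - 1) := by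
  have hq := ascPochhammer_eval_ne_zero (add_natCast_ne_zero hμ hμ0)
  by_cases h : n + 2 * k = j + 1
  · have hf : ∀ k : ℕ, (k.factorial : ℂ) ≠ 0 := fun k => by exact_mod_cast k.factorial_ne_zero
    rcases k with _ | k
    · obtain rfl : n = j + 1 := by omega
      have h1 := hq (j + 1)
      have h2 := add_natCast_ne_zero hμ hμ0 (j + 1)
      push_cast at h2
      simp only [powGegenbauerCoeff, Nat.factorial_succ, ascPochhammer_succ_eval (j + 1)]
      simp
      field_simp
      ring
    · have e : j = n + 2 * k + 1 := by omega
      have hk1 : (k : ℂ) + 1 ≠ 0 := Nat.cast_add_one_ne_zero k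
      have := hf k
      rcases n with _ | n
      · have h1 := hq (k + 1)
        have h2 := add_natCast_ne_zero hμ hμ0 (k + 1)
        subst e
        simp only [powGegenbauerCoeff, Nat.factorial_succ k, Nat.factorial_succ (_ + 1)]
        rw [if_pos (by omega), if_neg (by omega), if_neg (by omega), if_pos (by omega)]
        rw [show 0 + (k + 1) + 1 = k + 1 + 1 by ring,
          show 0 + 1 + (k + 1 - 1) + 1 = k + 1 + 1 by simp; ring, ascPochhammer_succ_eval (k + 1)]
        simp
        field_simp
        ring
      · have h1 := hq (n + 1 + k + 1)
        have h2 := add_natCast_ne_zero hμ hμ0 (n + 1 + k + 1)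
        subst e
        simp only [powGegenbauerCoeff, Nat.factorial_succ k, Nat.factorial_succ (_ + 1)]
        rw [if_pos (by omega), if_pos (by omega), if_neg (by omega), if_pos (by omega)]
        rw [show n + 1 + (k + 1) + 1 = n + 1 + k + 1 + 1 by ring,
          show n + 1 - 1 + (k + 1) + 1 = n + 1 + k + 1 by simp; ring,
          show n + 1 + 1 + (k + 1 - 1) + 1 = n + 1 + k + 1 + 1 by simp; ring,
          ascPochhammer_succ_eval (n + 1 + k + 1)]
        simp only [Nat.add_sub_cancel]
        push_cast at h2 ⊢
        field_simp
        ring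
  · rw [powGegenbauerCoeff_of_ne h]
    have h1 : (n : ℂ) * powGegenbauerCoeff μ j (n - 1) k = 0 := by
      rcases n with _ | n
      · simp
      · rw [powGegenbauerCoeff_of_ne (by omega), mul_zero]
    have h2 : (if k = 0 then 0 else ((n : ℂ) + 2 * μ) * powGegenbauerCoeff μ j (n + 1) (k - 1))
        = 0 := by
      split_ifs with hk
      · rfl
      · rw [powGegenbauerCoeff_of_ne (by omega), mul_zero]
    rw [h1, h2]
    simp

/-- The expansion of `x ^ j` in Gegenbauer polynomials. -/
theorem pow_eq_sum_gegenbauerC {μ : ℝ} (hμ : -(1 / 2) < μ) (hμ0 : μ ≠ 0) (x : ℂ) {j M : ℕ}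
    (hj : j < M) :
    x ^ j = ∑ n ∈ Finset.range M, ∑ k ∈ Finset.range M,
      powGegenbauerCoeff μ j n k * (n + μ) * gegenbauerC n μ x := by
  obtain ⟨M, rfl⟩ : ∃ M', M = M' + 1 := ⟨M - 1, by omega⟩
  induction j with
  | zero =>
    have h0 : ∀ n k : ℕ, n + 2 * k ≠ 0 →
        powGegenbauerCoeff μ 0 n k * (n + μ) * gegenbauerC n μ x = 0 := fun n k h => by
      rw [powGegenbauerCoeff_of_ne h]; simp
    rw [Finset.sum_eq_single 0, Finset.sum_eq_single 0]
    · have : (μ : ℂ) ≠ 0 := by exact_mod_cast hμ0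
      simp [powGegenbauerCoeff, gegenbauerC_zero, this]
    · exact fun k _ hk => h0 0 k (by omega)
    · simp
    · exact fun n _ hn => Finset.sum_eq_zero fun k _ => h0 n k (by omega)
    · simp
  | succ j ih =>
    set C : ℕ → ℂ := fun n => gegenbauerC n μ x with hC
    -- `up n`, `dn n`: contributions of `x C_(n-1)` and `x C_(n+1)` to the multiple of `C_n`.
    -- The boundary terms of the shifted sums vanish, since `n + 2 * k = j` forces `n ≤ j < M`.
    set up : ℕ → ℂ := fun n =>
      ∑ k ∈ Finset.range (M + 1), n * powGegenbauerCoeff μ j (n - 1) k * C n with hup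
    set dn : ℕ → ℂ := fun n =>
      ∑ k ∈ Finset.range (M + 1), (n + 2 * μ) * powGegenbauerCoeff μ j (n + 1) k * C n with hdn
    have hup0 : up 0 = 0 := by simp [hup]
    have hupM : up (M + 1) = 0 := by
      refine Finset.sum_eq_zero fun k _ => ?_
      rw [powGegenbauerCoeff_of_ne (by omega)]
      simp
    have hdnM : dn M = 0 := by
      refine Finset.sum_eq_zero fun k _ => ?_
      rw [powGegenbauerCoeff_of_ne (by omega)]
      simp
    have hrow0 : 2 * (x * ∑ k ∈ Finset.range (M + 1),
        powGegenbauerCoeff μ j 0 k * ((0 : ℕ) + μ) * C 0) = up 1 := by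
      simp only [hup, Finset.mul_sum]
      refine Finset.sum_congr rfl fun k _ => ?_
      simp only [hC, gegenbauerC_zero, gegenbauerC_one hμ]
      push_cast
      ring
    have hrow : ∀ n : ℕ, 2 * (x * ∑ k ∈ Finset.range (M + 1),
        powGegenbauerCoeff μ j (n + 1) k * ((n + 1 : ℕ) + μ) * C (n + 1)) = up (n + 2) + dn n := by
      intro n
      simp only [hup, hdn, Finset.mul_sum, ← Finset.sum_add_distrib]
      refine Finset.sum_congr rfl fun k _ => ?_
      have := gegenbauerC_recurrence hμ n x
      simp only [hC, show n + 2 - 1 = n + 1 by omega]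
      push_cast
      linear_combination powGegenbauerCoeff μ j (n + 1) k * this
    have hdn' : ∀ n : ℕ, dn n = ∑ k ∈ Finset.range (M + 1),
        (if k = 0 then 0 else (n + 2 * μ) * powGegenbauerCoeff μ j (n + 1) (k - 1)) * C n := by
      intro n
      rw [Finset.sum_range_succ']
      simp only [hdn]
      rw [Finset.sum_range_succ, powGegenbauerCoeff_of_ne (show n + 1 + 2 * M ≠ j by omega)]
      simp
    have hgoal : 2 * ∑ n ∈ Finset.range (M + 1), ∑ k ∈ Finset.range (M + 1),
          powGegenbauerCoeff μ (j + 1) n k * (n + μ) * C n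
        = ∑ n ∈ Finset.range (M + 1), (up n + dn n) := by
      rw [Finset.mul_sum]
      refine Finset.sum_congr rfl fun n _ => ?_
      rw [hdn' n]
      simp only [hup, Finset.mul_sum, ← Finset.sum_add_distrib]
      refine Finset.sum_congr rfl fun k _ => ?_
      linear_combination C n * powGegenbauerCoeff_succ hμ hμ0 j n k
    have hpow : 2 * x ^ (j + 1) = ∑ n ∈ Finset.range (M + 1), (up n + dn n) := by
      rw [pow_succ', ih (by omega), Finset.sum_range_succ', mul_add x, mul_add 2, hrow0,
        Finset.mul_sum, Finset.mul_sum, Finset.sum_congr rfl fun n _ => hrow n,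
        Finset.sum_add_distrib, Finset.sum_add_distrib]
      have h1 := Finset.sum_range_succ' up (M + 1)
      rw [Finset.sum_range_succ up, hupM, hup0] at h1
      have h2 := Finset.sum_range_succ' (fun n => up (n + 1)) M
      simp only [zero_add, add_assoc, one_add_one_eq_two] at h2
      rw [Finset.sum_range_succ dn, hdnM]
      linear_combination -h1 - h2
    exact mul_left_cancel₀ two_ne_zero (hpow.trans hgoal.symm)

/-- The Gegenbauer expansion of `(z - x) ^ p` with polynomial coefficients in `z`. The falling
factorial cuts the inner sum at `2 * k ≤ p - n`. -/
theorem sub_pow_eq_sum_gegenbauerC {μ : ℝ} (hμ : -(1 / 2) < μ) (hμ0 : μ ≠ 0) (p : ℕ) {z : ℂ}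
    (hz : z ≠ 0) (x : ℂ) :
    (z - x) ^ p = ∑ n ∈ Finset.range (p + 1), ∑ k ∈ Finset.range (p + 1),
      (-1 : ℂ) ^ n * (p.factorial : ℂ) * ((p - n).descFactorial (2 * k) : ℂ) * (n + μ)
        * gegenbauerC n μ x * z ^ (p - n) * (1 / z ^ 2) ^ k
        / (2 ^ n * 4 ^ k * (k.factorial : ℂ) * ((p - n).factorial : ℂ)
          * (ascPochhammer ℂ (n + k + 1)).eval (μ : ℂ)) := by
  have hq := ascPochhammer_eval_ne_zero (add_natCast_ne_zero hμ hμ0)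
  have hf : ∀ k : ℕ, (k.factorial : ℂ) ≠ 0 := fun k => by exact_mod_cast k.factorial_ne_zero
  rw [show z - x = -x + z by ring, add_pow]
  have h1 : ∀ j ∈ Finset.range (p + 1), (-x) ^ j * z ^ (p - j) * (p.choose j : ℂ)
      = ∑ n ∈ Finset.range (p + 1), ∑ k ∈ Finset.range (p + 1),
        if n + 2 * k = j then (-1) ^ j * z ^ (p - j) * (p.choose j : ℂ)
          * ((j.factorial : ℂ)
            / (2 ^ j * (ascPochhammer ℂ (n + k + 1)).eval (μ : ℂ) * (k.factorial : ℂ))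
            * (n + μ) * gegenbauerC n μ x) else 0 := by
    intro j hj
    rw [neg_pow, pow_eq_sum_gegenbauerC hμ hμ0 x (Finset.mem_range.mp hj)]
    simp only [Finset.mul_sum, Finset.sum_mul]
    refine Finset.sum_congr rfl fun n _ => Finset.sum_congr rfl fun k _ => ?_
    rw [powGegenbauerCoeff]
    split_ifs
    · ring
    · ring
  rw [Finset.sum_congr rfl h1, Finset.sum_comm]
  refine Finset.sum_congr rfl fun n hn => ?_
  rw [Finset.sum_comm]
  refine Finset.sum_congr rfl fun k _ => ?_
  rw [Finset.sum_ite_eq]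
  split_ifs with h
  · obtain ⟨i, rfl⟩ := Nat.exists_eq_add_of_le (Nat.lt_succ_iff.mp (Finset.mem_range.mp h))
    have e1 : n + 2 * k + i - n = i + 2 * k := by omega
    have e2 : n + 2 * k + i - (n + 2 * k) = i := by omega
    have e3 : ((i + 2 * k).descFactorial (2 * k) : ℂ)
        = ((i + 2 * k).factorial : ℂ) / (i.factorial : ℂ) := by
      rw [eq_div_iff (hf i)]
      have := Nat.factorial_mul_descFactorial (show 2 * k ≤ i + 2 * k by omega)
      rw [Nat.add_sub_cancel] at this
      rw [mul_comm]
      exact_mod_cast this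
    have e4 : ((n + 2 * k + i).choose (n + 2 * k) : ℂ)
        = ((n + 2 * k + i).factorial : ℂ) / (((n + 2 * k).factorial : ℂ) * (i.factorial : ℂ)) := by
      rw [Nat.cast_choose ℂ (by omega), e2]
    rw [e1, e2, e3, e4]
    have := hq (n + k + 1)
    have := hf k
    have := hf i
    have := hf (n + 2 * k)
    have := hf (i + 2 * k)
    rw [pow_add (-1 : ℂ), pow_mul (-1 : ℂ), pow_add z i, pow_mul z, pow_add (2 : ℂ),
      pow_mul (2 : ℂ), show (2 : ℂ) ^ 2 = 4 by norm_num, div_pow, one_pow]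
    simp only [neg_one_sq, one_pow]
    field_simp
  · have : (p - n).descFactorial (2 * k) = 0 := by
      rw [Nat.descFactorial_eq_zero_iff_lt]
      simp only [Finset.mem_range] at h hn
      omega
    simp [this]

/-! ### The Legendre functions occurring in the expansion -/

theorem ascPochhammer_eval_half_mul (m k : ℕ) :
    (ascPochhammer ℂ k).eval ((1 - m) / 2 : ℂ) * (ascPochhammer ℂ k).eval (-m / 2 : ℂ)
      = (m.descFactorial (2 * k) : ℂ) / 4 ^ k := by
  rw [← descPochhammer_eval_eq_descFactorial]
  induction k with
  | zero => simp
  | succ k ih =>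
    rw [ascPochhammer_succ_eval, ascPochhammer_succ_eval, mul_add 2 k 1, mul_one,
      show 2 * k + 2 = 2 * k + 1 + 1 by ring, descPochhammer_succ_eval, descPochhammer_succ_eval,
      pow_succ]
    have h4 : (4 : ℂ) ≠ 0 := by norm_num
    rw [eq_div_iff (pow_ne_zero k h4)] at ih
    rw [eq_div_iff (mul_ne_zero (pow_ne_zero k h4) h4)]
    push_cast
    linear_combination ((2 * (k : ℂ) + 1 - m) * (2 * k - m)) * ih

/-- After Euler's transformation, each Legendre function of the expansion is a power of `z² - 1`
times a polynomial in `z`, here `z ^ (p - n)` times a polynomial in `1 / z ^ 2`. -/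
theorem sqSubOnePow_mul_legendreQ {μ : ℝ} (hμ : -(1 / 2) < μ) {n p : ℕ} (hn : n ≤ p) {z : ℂ}
    (hz : z ∉ Complex.ofReal '' Set.Iic (1 : ℝ)) :
    sqSubOnePow z (((p : ℂ) + μ) / 2 + 1 / 4)
        * legendreQ ((n : ℂ) + μ - 1 / 2) ((p : ℂ) + μ + 1 / 2) z
      = (Real.sqrt Real.pi : ℂ) * Complex.exp (Complex.I * Real.pi * ((p : ℂ) + μ + 1 / 2))
          * Complex.Gamma ((n : ℂ) + p + 2 * μ + 1)
          / ((2 : ℂ) ^ ((μ : ℂ) + 1 / 2) * 2 ^ n * Complex.Gamma ((n : ℂ) + μ + 1))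
          * ∑ k ∈ Finset.range (p + 1), ((p - n).descFactorial (2 * k) : ℂ)
              / (4 ^ k * (k.factorial : ℂ) * (ascPochhammer ℂ k).eval ((n : ℂ) + μ + 1))
              * z ^ (p - n) * (1 / z ^ 2) ^ k := by
  have hz0 := ne_zero_of_notMem_image_Iic hz
  have hc : ∀ k : ℕ, ((n : ℂ) + μ + 1) + k ≠ 0 := by
    intro k
    have h : (0 : ℝ) < n + μ + 1 + k := by
      have : (0 : ℝ) ≤ k := k.cast_nonneg
      have : (0 : ℝ) ≤ n := n.cast_nonneg
      linarith
    exact_mod_cast Complex.ofReal_ne_zero.mpr h.ne'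
  have hF := gaussHypergeometric_eq_one_sub_cpow_mul_sum ((1 - (p - n : ℕ)) / 2 : ℂ)
    (-(p - n : ℕ) / 2 : ℂ) ((n : ℂ) + μ + 1) hc p (by
      intro k hk
      rw [ascPochhammer_eval_half_mul, Nat.descFactorial_eq_zero_iff_lt.mpr (by omega)]
      simp) (one_div_sq_mem_gaussDomain hz)
  simp only [ascPochhammer_eval_half_mul] at hF
  rw [Nat.cast_sub hn] at hF
  have ea : ((n : ℂ) + μ + 1) - (1 - ((p : ℂ) - n)) / 2
      = ((n : ℂ) + μ - 1 / 2 + (p + μ + 1 / 2) + 1) / 2 := by ring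
  have eb : ((n : ℂ) + μ + 1) - -((p : ℂ) - n) / 2
      = ((n : ℂ) + μ - 1 / 2 + (p + μ + 1 / 2) + 2) / 2 := by ring
  have es : (1 - ((p : ℂ) - n)) / 2 + -((p : ℂ) - n) / 2 - ((n : ℂ) + μ + 1)
      = -((p : ℂ) + μ + 1 / 2) := by ring
  rw [ea, eb, es] at hF
  have ec : (n : ℂ) + μ - 1 / 2 + 3 / 2 = n + μ + 1 := by ring
  have eg : (n : ℂ) + μ - 1 / 2 + (p + μ + 1 / 2) + 1 = n + p + 2 * μ + 1 := by ring
  have e2 : (2 : ℂ) ^ ((n : ℂ) + μ - 1 / 2 + 1) = 2 ^ ((μ : ℂ) + 1 / 2) * 2 ^ n := by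
    rw [← Complex.cpow_natCast, ← Complex.cpow_add _ _ two_ne_zero]
    congr 1
    ring
  -- All powers of `z`, `z ± 1` and `1 - 1 / z ^ 2` combine to `z ^ (p - n)`.
  have hpow : sqSubOnePow z (((p : ℂ) + μ) / 2 + 1 / 4) * sqSubOnePow z (((p : ℂ) + μ + 1 / 2) / 2)
      * (1 - 1 / z ^ 2) ^ (-((p : ℂ) + μ + 1 / 2))
      = z ^ (p - n) * z ^ ((n : ℂ) + p + 2 * μ + 1) := by
    rw [← sqSubOnePow_add hz, show ((p : ℂ) + μ) / 2 + 1 / 4 + ((p : ℂ) + μ + 1 / 2) / 2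
      = (p : ℂ) + μ + 1 / 2 by ring, sqSubOnePow_mul_one_sub_cpow_neg hz, ← Complex.cpow_natCast,
      ← Complex.cpow_add _ _ hz0, Nat.cast_sub hn]
    congr 1
    ring
  have hzp : z ^ ((n : ℂ) + p + 2 * μ + 1) ≠ 0 := by
    rw [Complex.cpow_def_of_ne_zero hz0]
    exact Complex.exp_ne_zero _
  rw [legendreQ, ec, hF, eg, e2]
  have hsum : ∑ k ∈ Finset.range (p + 1), ((p - n).descFactorial (2 * k) : ℂ)
              / (4 ^ k * (k.factorial : ℂ) * (ascPochhammer ℂ k).eval ((n : ℂ) + μ + 1))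
              * z ^ (p - n) * (1 / z ^ 2) ^ k
      = z ^ (p - n) * ∑ k ∈ Finset.range (p + 1), ((p - n).descFactorial (2 * k) : ℂ) / 4 ^ k
          / ((ascPochhammer ℂ k).eval ((n : ℂ) + μ + 1) * (k.factorial : ℂ)) * (1 / z ^ 2) ^ k := by
    rw [Finset.mul_sum]
    refine Finset.sum_congr rfl fun k _ => ?_
    simp only [div_eq_mul_inv, mul_inv]
    ring
  rw [hsum]
  generalize ∑ k ∈ Finset.range (p + 1), ((p - n).descFactorial (2 * k) : ℂ) / 4 ^ k
          / ((ascPochhammer ℂ k).eval ((n : ℂ) + μ + 1) * (k.factorial : ℂ)) * (1 / z ^ 2) ^ k = S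
  have hzz : z ^ (p - n) = sqSubOnePow z (((p : ℂ) + μ) / 2 + 1 / 4)
      * sqSubOnePow z (((p : ℂ) + μ + 1 / 2) / 2)
      * (1 - 1 / z ^ 2) ^ (-((p : ℂ) + μ + 1 / 2)) / z ^ ((n : ℂ) + p + 2 * μ + 1) := by
    rw [hpow, mul_div_cancel_right₀ _ hzp]
  rw [hzz]
  simp only [div_eq_mul_inv, mul_inv]
  ring

theorem mainTheorem10 (p : ℕ) (μ : ℝ) (hμ : -(1 / 2) < μ) (hμ0 : μ ≠ 0)
    (z : ℂ) (hz : z ∉ Complex.ofReal '' Set.Iic (1 : ℝ)) (x : ℂ) :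
    (z - x) ^ p =
      (2 : ℂ) ^ ((μ : ℂ) + 1 / 2) / (Real.sqrt Real.pi : ℂ)
        * Complex.exp (Complex.I * Real.pi * ((p : ℂ) - μ - 1 / 2))
        * Complex.Gamma (μ : ℂ) * (p.factorial : ℂ)
        * sqSubOnePow z (((p : ℂ) + μ) / 2 + 1 / 4)
        * ∑ n ∈ Finset.range (p + 1),
            (-1 : ℂ) ^ n * ((n : ℂ) + μ) * gegenbauerC n μ x
              / (((p - n).factorial : ℂ) * Complex.Gamma ((n : ℂ) + p + 2 * μ + 1))
              * legendreQ ((n : ℂ) + μ - 1 / 2) ((p : ℂ) + μ + 1 / 2) z := by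
  have hz0 := ne_zero_of_notMem_image_Iic hz
  have hμk := add_natCast_ne_zero hμ hμ0
  have hμneg : ∀ k : ℕ, (μ : ℂ) ≠ -k := fun k h => hμk k (by rw [h]; ring)
  have hΓ : Complex.Gamma (μ : ℂ) ≠ 0 := Complex.Gamma_ne_zero hμneg
  have hπ : (Real.sqrt Real.pi : ℂ) ≠ 0 := by
    exact_mod_cast (Real.sqrt_pos.mpr Real.pi_pos).ne'
  have h2 : (2 : ℂ) ^ ((μ : ℂ) + 1 / 2) ≠ 0 := by
    rw [Complex.cpow_def_of_ne_zero two_ne_zero]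
    exact Complex.exp_ne_zero _
  -- The phases of the prefactor and of the Legendre functions cancel.
  have hexp : Complex.exp (Complex.I * Real.pi * ((p : ℂ) - μ - 1 / 2))
      * Complex.exp (Complex.I * Real.pi * ((p : ℂ) + μ + 1 / 2)) = 1 := by
    rw [← Complex.exp_add, Complex.exp_eq_one_iff]
    exact ⟨p, by push_cast; ring⟩
  rw [sub_pow_eq_sum_gegenbauerC hμ hμ0 p hz0, Finset.mul_sum]
  refine Finset.sum_congr rfl fun n hn => ?_
  replace hn : n ≤ p := Nat.lt_succ_iff.mp (Finset.mem_range.mp hn)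
  have hΓn : Complex.Gamma ((n : ℂ) + μ + 1)
      = Complex.Gamma (μ : ℂ) * (ascPochhammer ℂ (n + 1)).eval (μ : ℂ) := by
    rw [← Complex.Gamma_add_nat_div_Gamma_eq _ hμneg, mul_div_cancel₀ _ hΓ]
    congr 1
    push_cast
    ring
  have hΓp : Complex.Gamma ((n : ℂ) + p + 2 * μ + 1) ≠ 0 := by
    refine Complex.Gamma_ne_zero_of_re_pos ?_
    have : (0 : ℝ) ≤ p := p.cast_nonneg
    have : (0 : ℝ) ≤ n := n.cast_nonneg
    simp
    linarith
  have hQ := sqSubOnePow_mul_legendreQ hμ hn hz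
  have hpoch : ∀ k : ℕ, (ascPochhammer ℂ (n + k + 1)).eval (μ : ℂ)
      = (ascPochhammer ℂ (n + 1)).eval (μ : ℂ) * (ascPochhammer ℂ k).eval ((n : ℂ) + μ + 1) := by
    intro k
    rw [show n + k + 1 = n + 1 + k by ring, ascPochhammer_eval_add]
    congr 2
    push_cast
    ring
  have hp1 := ascPochhammer_eval_ne_zero hμk (n + 1)
  calc _ = (-1 : ℂ) ^ n * (p.factorial : ℂ) * (n + μ) * gegenbauerC n μ x
          / (2 ^ n * ((p - n).factorial : ℂ) * (ascPochhammer ℂ (n + 1)).eval (μ : ℂ))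
          * ∑ k ∈ Finset.range (p + 1), ((p - n).descFactorial (2 * k) : ℂ)
              / (4 ^ k * (k.factorial : ℂ) * (ascPochhammer ℂ k).eval ((n : ℂ) + μ + 1))
              * z ^ (p - n) * (1 / z ^ 2) ^ k := by
        rw [Finset.mul_sum]
        refine Finset.sum_congr rfl fun k _ => ?_
        rw [hpoch]
        simp only [div_eq_mul_inv, mul_inv]
        ring
    _ = (2 : ℂ) ^ ((μ : ℂ) + 1 / 2) / (Real.sqrt Real.pi : ℂ)
        * Complex.exp (Complex.I * Real.pi * ((p : ℂ) - μ - 1 / 2))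
        * Complex.Gamma (μ : ℂ) * (p.factorial : ℂ)
        * ((-1 : ℂ) ^ n * ((n : ℂ) + μ) * gegenbauerC n μ x
              / (((p - n).factorial : ℂ) * Complex.Gamma ((n : ℂ) + p + 2 * μ + 1)))
        * (sqSubOnePow z (((p : ℂ) + μ) / 2 + 1 / 4)
          * legendreQ ((n : ℂ) + μ - 1 / 2) ((p : ℂ) + μ + 1 / 2) z) := by
        rw [hQ, hΓn]
        generalize ∑ k ∈ Finset.range (p + 1), ((p - n).descFactorial (2 * k) : ℂ)
              / (4 ^ k * (k.factorial : ℂ) * (ascPochhammer ℂ k).eval ((n : ℂ) + μ + 1))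
              * z ^ (p - n) * (1 / z ^ 2) ^ k = S
        have hf : ((p - n).factorial : ℂ) ≠ 0 := by exact_mod_cast (p - n).factorial_ne_zero
        generalize (2 : ℂ) ^ ((μ : ℂ) + 1 / 2) = T at *
        generalize Complex.exp (Complex.I * Real.pi * ((p : ℂ) - μ - 1 / 2)) = E₁ at *
        generalize Complex.exp (Complex.I * Real.pi * ((p : ℂ) + μ + 1 / 2)) = E₂ at *
        generalize Complex.Gamma ((n : ℂ) + p + 2 * μ + 1) = G at *
        field_simp
        linear_combination (-(p.factorial : ℂ) * (n + μ) * gegenbauerC n μ x * S) * hexp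
    _ = _ := by ring
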